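/- A total-coloring of a finite simple graph $G$ assigns a color to every vertex and every edge of $G$ (with no restriction). In a total-colored graph, a path is a total proper path if (i) any two adjacent edges on the path differ in color, (ii) any two internal vertices that are adjacent on the path differ in color, and (iii) any internal vertex of the path differs in color from its incident edges on the path. For a connected graph $G$, the total proper connection number $tpc(G)$ is the smallest number of colors in a total-coloring of $G$ under which any two vertices are connected by a total proper path. Let $G$ be a connected finite simple graph, and let $\widetilde{\Delta}(G)$ denote the maximum degree in $G$ of a vertex that is an endpoint of a bridge of $G$ (with $\widetilde{\Delta}(G)=0$ if $G$ has no bridge). Then $tpc(G)\le\widetilde{\Delta}(G)+1$ if $\widetilde{\Delta}(G)\ge 4$, and $tpc(G)\le 4$ otherwise. -/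

import Mathlib

namespace TotalProper

open SimpleGraph

/-- A total-coloring with colors in `K`: every vertex and every edge gets a color, with no
constraint. Edges are unordered pairs; the values of `edge` on pairs that are not edges of the
graph are never used. -/
structure TotalColoring (V K : Type*) where
  vert : V → K
  edge : Sym2 V → K

/-- The internal vertices of a walk, in order: all vertices but the first and the last one. -/
def internalVertices {V : Type*} {G : SimpleGraph V} {u v : V} (p : G.Walk u v) : List V :=
  p.support.tail.dropLast

/-- `p` is a total proper path under the total-coloring `c`. -/
structure IsTotalProperPath {V K : Type*} {G : SimpleGraph V} (c : TotalColoring V K) {u v : V}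
    (p : G.Walk u v) : Prop where
  isPath : p.IsPath
  /-- Adjacent edges on the path differ in color. -/
  edges_ne : (p.edges.map c.edge).IsChain (· ≠ ·)
  /-- Adjacent internal vertices on the path differ in color. -/
  verts_ne : ((internalVertices p).map c.vert).IsChain (· ≠ ·)
  /-- An internal vertex differs in color from its incident edges on the path. -/
  vert_ne_edge : ∀ x ∈ internalVertices p, ∀ e ∈ p.edges, x ∈ e → c.vert x ≠ c.edge e

/-- `c` makes `G` total proper connected. -/
def IsTotalProperConnected {V K : Type*} (G : SimpleGraph V) (c : TotalColoring V K) : Prop :=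
  ∀ u v : V, ∃ p : G.Walk u v, IsTotalProperPath c p

/-- The total proper connection number: the smallest number of colors with which `G` can be made
total proper connected (`⊤` if there is no such number, as for a disconnected graph). -/
noncomputable def tpc {V : Type*} (G : SimpleGraph V) : ℕ∞ :=
  ⨅ (k : ℕ) (_ : ∃ c : TotalColoring V (Fin k), IsTotalProperConnected G c), (k : ℕ∞)

/-- `v` is an endpoint of a bridge of `G`. -/
def IsBridgeEndpoint {V : Type*} (G : SimpleGraph V) (v : V) : Prop :=
  ∃ e ∈ G.edgeSet, G.IsBridge e ∧ v ∈ e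

open Classical in
/-- The maximum degree in `G` of a vertex that is an endpoint of a bridge; `0` if `G` has no
bridge. -/
noncomputable def maxBridgeDegree {V : Type*} [Fintype V] (G : SimpleGraph V) : ℕ :=
  (Finset.univ.filter fun v => IsBridgeEndpoint G v).sup fun v => G.degree v

end TotalProper

/-! The links of `Linked` treat both ends of a path as internal vertices with prescribed outer
colors, so that they can be glued along edges.

In a bridgeless graph four colors suffice even with one color `φ v` reserved at each vertex:
distinct `u`, `v` are joined by a proper path extendable by an edge of color `φ u` at `u` and `φ v`
at `v`. This is proved by adding ears (`ReservingOn.exists_union_ear`). The first edge of an ear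
gets the color reserved at its attachment `x`, so inner vertices reach all old vertices but `x`
through it; `x` is reached through the other end.

Bridges are removed by induction: deleting one costs one more reserved color at each of its ends,
where the degree drops by one, so degree plus number of reserved colors stays at most `k - 1`. Once
no bridge is left, a vertex with reserved colors is isolated or has degree at least 2, hence needs
at most `k - 3` of them: `φ v` and the `k - 4` colors beyond the first four. To restore a bridge
(`ReservingSets.of_deleteEdges`), the colors on one side are permuted until a reserved color of each
end agrees, and the bridge takes it. Taking `k` as the maximum of 4 and the bridge degree plus one
gives the theorem. -/

namespace TotalProper

open SimpleGraph

variable {V K : Type*}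

/-! ### Properly colored links -/

/-- The ends of the pair `a, b` and the pair itself have three distinct colors. -/
def ProperPair (c : TotalColoring V K) (a b : V) : Prop :=
  c.vert a ≠ c.vert b ∧ c.vert a ≠ c.edge s(a, b) ∧ c.vert b ≠ c.edge s(a, b)

/-- Some path of `G` inside `A` from `u` to `v` is properly colored, with its ends treated as
internal vertices that are entered through an edge of color `α` and left through one of
color `β`. -/
def Linked (G : SimpleGraph V) (c : TotalColoring V K) (A : Set V) (α : K) (u v : V) (β : K) :
    Prop :=
  ∃ p : G.Walk u v, p.support.Nodup ∧ (∀ w ∈ p.support, w ∈ A) ∧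
    (∀ a b, s(a, b) ∈ p.edges → ProperPair c a b) ∧
    (α :: (p.edges.map c.edge ++ [β])).IsChain (· ≠ ·)

theorem ProperPair.symm {c : TotalColoring V K} {a b : V} (h : ProperPair c a b) :
    ProperPair c b a := by
  obtain ⟨h1, h2, h3⟩ := h
  refine ⟨h1.symm, ?_, ?_⟩ <;> rw [Sym2.eq_swap] <;> assumption

namespace Linked

variable {G : SimpleGraph V} {c : TotalColoring V K} {A B : Set V} {α β : K} {u v : V}

theorem nil (hu : u ∈ A) (h : α ≠ β) : Linked G c A α u u β :=
  ⟨.nil, by simp, by simpa using hu, by simp, by simpa using h⟩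

theorem symm (h : Linked G c A α u v β) : Linked G c A β v u α := by
  obtain ⟨p, hp, hA, hc, hch⟩ := h
  refine ⟨p.reverse, by simpa using hp, by simpa using hA, by simpa using hc, ?_⟩
  have := List.isChain_reverse.2 (hch.imp fun _ _ => Ne.symm)
  simpa using this

theorem mono (h : Linked G c A α u v β) {G' : SimpleGraph V} (hG : G ≤ G') (hA : A ⊆ B) :
    Linked G' c B α u v β := by
  obtain ⟨p, hp, hpA, hc, hch⟩ := h
  exact ⟨p.mapLe hG, by simpa using hp, fun w hw => hA (hpA w (by simpa using hw)),
    by simpa using hc, by simpa using hch⟩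

theorem inter_reachable (h : Linked G c A α u v β) :
    Linked G c (A ∩ {w | G.Reachable u w}) α u v β := by
  classical
  obtain ⟨p, hp, hA, hc, hch⟩ := h
  exact ⟨p, hp, fun w hw => ⟨hA w hw, ⟨p.takeUntil w hw⟩⟩, hc, hch⟩

/-- Recoloring outside `A`. -/
theorem congr (h : Linked G c A α u v β) {c' : TotalColoring V K}
    (hv : ∀ a ∈ A, c'.vert a = c.vert a)
    (he : ∀ a ∈ A, ∀ b ∈ A, G.Adj a b → c'.edge s(a, b) = c.edge s(a, b)) :
    Linked G c' A α u v β := by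
  obtain ⟨p, hp, hA, hc, hch⟩ := h
  have key : ∀ a b, s(a, b) ∈ p.edges →
      a ∈ A ∧ b ∈ A ∧ c'.edge s(a, b) = c.edge s(a, b) := fun a b hab => by
    have ha := hA a (p.fst_mem_support_of_mem_edges hab)
    have hb := hA b (p.snd_mem_support_of_mem_edges hab)
    exact ⟨ha, hb, he a ha b hb (p.adj_of_mem_edges hab)⟩
  refine ⟨p, hp, hA, fun a b hab => ?_, ?_⟩
  · obtain ⟨ha, hb, hab'⟩ := key a b hab
    have := hc a b hab
    rwa [ProperPair, hv a ha, hv b hb, hab']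
  · have : p.edges.map c'.edge = p.edges.map c.edge := by
      refine List.map_congr_left fun e hep => ?_
      induction e with
      | h a b => exact (key a b hep).2.2
    rwa [this]

/-- Recoloring through an injective map of colors. -/
theorem map_colors {L : Type*} (h : Linked G c A α u v β) {f : K → L} (hf : Function.Injective f) :
    Linked G ⟨f ∘ c.vert, f ∘ c.edge⟩ A (f α) u v (f β) := by
  obtain ⟨p, hp, hA, hc, hch⟩ := h
  refine ⟨p, hp, hA, fun a b hab => ?_, ?_⟩
  · obtain ⟨h1, h2, h3⟩ := hc a b hab
    exact ⟨hf.ne h1, hf.ne h2, hf.ne h3⟩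
  · have : f α :: (p.edges.map (f ∘ c.edge) ++ [f β]) =
        (α :: (p.edges.map c.edge ++ [β])).map f := by simp
    simp only [this, List.isChain_map]
    exact hch.imp fun _ _ => hf.ne

/-- Two links with disjoint supports are joined by an edge. -/
theorem join {a b : V} (h₁ : Linked G c A α u a (c.edge s(a, b)))
    (hab : G.Adj a b) (hc : ProperPair c a b)
    (h₂ : Linked G c B (c.edge s(a, b)) b v β) (hAB : Disjoint A B) :
    Linked G c (A ∪ B) α u v β := by
  obtain ⟨p, hp, hpA, hpc, hpch⟩ := h₁
  obtain ⟨q, hq, hqB, hqc, hqch⟩ := h₂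
  refine ⟨p.append (.cons hab q), ?_, ?_, ?_, ?_⟩
  · rw [Walk.support_append]
    simp only [Walk.support_cons, List.tail_cons]
    exact hp.append hq fun w hw hw' => Set.disjoint_left.1 hAB (hpA w hw) (hqB w hw')
  · intro w hw
    rw [Walk.support_append] at hw
    simp only [Walk.support_cons, List.tail_cons, List.mem_append] at hw
    exact hw.imp (hpA w) (hqB w)
  · intro x y hxy
    simp only [Walk.edges_append, Walk.edges_cons, List.mem_append, List.mem_cons] at hxy
    rcases hxy with h | h | h
    · exact hpc x y h
    · rcases Sym2.eq_iff.1 h with ⟨rfl, rfl⟩ | ⟨rfl, rfl⟩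
      exacts [hc, hc.symm]
    · exact hqc x y h
  · simp only [Walk.edges_append, Walk.edges_cons, List.map_append, List.map_cons,
      List.append_assoc, List.cons_append]
    rw [← List.cons_append, List.isChain_split]
    exact ⟨by simpa using hpch, hqch⟩

/-- The outer color matters only through the first edge. In particular the color of `u` itself, or a
color absent from the edges at `u`, is always admissible. -/
theorem start_ne (h : Linked G c A α u v β) (huv : u ≠ v) {γ : K}
    (hγ : ∀ w, G.Adj u w → ProperPair c u w → w ∈ A → γ ≠ c.edge s(u, w)) :
    Linked G c A γ u v β := by
  obtain ⟨p, hp, hA, hc, hch⟩ := h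
  refine ⟨p, hp, hA, hc, ?_⟩
  cases p with
  | nil => exact absurd rfl huv
  | cons h q =>
    simp only [Walk.edges_cons, List.map_cons, List.cons_append, List.isChain_cons_cons] at hch ⊢
    exact ⟨hγ _ h (hc _ _ (by simp)) (hA _ (by simp)), hch.2⟩

/-- A nontrivial link has a first edge color, and any other color may precede it. -/
theorem exists_first (h : Linked G c A α u v β) (huv : u ≠ v) :
    ∃ q, ∀ γ ≠ q, Linked G c A γ u v β := by
  obtain ⟨p, hp, hA, hc, hch⟩ := h
  cases p with
  | nil => exact absurd rfl huv
  | @cons _ w _ h q =>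
    refine ⟨c.edge s(u, w), fun γ hγ => ⟨.cons h q, hp, hA, hc, ?_⟩⟩
    simp only [Walk.edges_cons, List.map_cons, List.cons_append, List.isChain_cons_cons] at hch ⊢
    exact ⟨hγ, hch.2⟩

theorem isTotalProperPath (h : Linked G c A α u v β) :
    ∃ p : G.Walk u v, IsTotalProperPath c p := by
  obtain ⟨p, hp, hA, hc, hch⟩ := h
  refine ⟨p, .mk' hp, ?_, ?_, ?_⟩
  · exact hch.tail.left_of_append
  · have : ∀ {a b : V} (r : G.Walk a b), (∀ x y, s(x, y) ∈ r.edges → ProperPair c x y) →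
        (r.support.map c.vert).IsChain (· ≠ ·) := by
      intro a b r
      induction r with
      | nil => simp
      | cons h r ih =>
        intro hr
        have h1 := ih fun x y hxy => hr x y (by simp [hxy])
        rw [← Walk.cons_tail_support] at h1 ⊢
        have h2 := (hr _ _ (List.mem_cons_self ..)).1
        rw [Walk.support_cons, List.tail_cons, ← Walk.cons_tail_support]
        simp only [List.map_cons, List.isChain_cons_cons] at h1 ⊢
        exact ⟨h2, h1⟩
    rw [internalVertices, List.map_dropLast, List.map_tail]
    exact (this p hc).tail.dropLast
  · intro x _ e he hxe
    obtain ⟨y, rfl⟩ := hxe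
    exact (hc x y he).2.1

end Linked

/-! ### Coloring the inside of an ear -/

-- One step along an ear: `A`, `l` are the colors of the preceding vertex and edge, `C`, `e` those
-- of the current vertex and the next edge. The last clause looks ahead: if the next vertex is the
-- last one, colors `C'`, `t` for it and the closing edge still exist.
set_option synthInstance.maxHeartbeats 200000 in
set_option synthInstance.maxSize 1000 in
set_option maxRecDepth 4000 in
theorem exists_two_colors (A l D q : Fin 4) (h : A ≠ l) :
    ∃ C e, C ≠ A ∧ C ≠ l ∧ e ≠ l ∧ e ≠ C ∧
      ∃ C' t, (C' ≠ C ∧ C' ≠ e ∧ C' ≠ D) ∧ t ≠ D ∧ t ≠ q ∧ t ≠ C' ∧ t ≠ e := by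
  revert A l D q; decide

theorem exists_ne_three (x y z : Fin 4) : ∃ w, w ≠ x ∧ w ≠ y ∧ w ≠ z := by
  revert x y z; decide

/-- `c` colors the inside of an ear, a walk from `a` to `b`, so that the ear can be entered at `a`
through color `l` and at `b` through color `t`. -/
structure EarColoring (G : SimpleGraph V) {a b : V} (W : G.Walk a b)
    (c : TotalColoring V K) (φ : V → K) (l t : K) : Prop where
  ne : ∀ u ∈ W.support, φ u ≠ c.vert u
  start : ∀ u ∈ W.support, Linked G c {w | w ∈ W.support} (φ u) u a l
  finish : ∀ u ∈ W.support, Linked G c {w | w ∈ W.support} (φ u) u b t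
  link : ∀ u ∈ W.support, ∀ v ∈ W.support, u ≠ v →
    Linked G c {w | w ∈ W.support} (φ u) u v (φ v)

/-- The inside of an ear can be colored, the color of its first edge being given, while its last
edge has to avoid two colors; an ear with one inner vertex needs room at its ends. -/
theorem exists_earColoring_through {G : SimpleGraph V} (D q : Fin 4) {a b : V} (W : G.Walk a b)
    (hW : W.support.Nodup) (A l : Fin 4) (hAl : A ≠ l)
    (h0 : W.length = 0 →
      ∃ C t, (C ≠ A ∧ C ≠ l ∧ C ≠ D) ∧ t ≠ D ∧ t ≠ q ∧ t ≠ C ∧ t ≠ l) :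
    ∃ (c : TotalColoring V (Fin 4)) (φ : V → Fin 4) (t : Fin 4), EarColoring G W c φ l t ∧
      (t ≠ D ∧ t ≠ q ∧ c.vert a ≠ A ∧ c.vert a ≠ l ∧ c.vert b ≠ D ∧ c.vert b ≠ t) ∧
      Linked G c {w | w ∈ W.support} l a b t := by
  classical
  induction W generalizing A l with
  | @nil a =>
    obtain ⟨C, t, ⟨h1, h2, h3⟩, h4, h5, h6, h7⟩ := h0 rfl
    obtain ⟨f, hfl, hft, hfC⟩ := exists_ne_three l t C
    refine ⟨⟨fun _ => C, fun _ => C⟩, fun _ => f, t, ⟨?_, ?_, ?_, ?_⟩,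
      ⟨h4, h5, h1, h2, h3, h6.symm⟩, .nil (by simp) h7.symm⟩
    · simpa using hfC
    · simpa using Linked.nil (by simp) hfl
    · simpa using Linked.nil (by simp) hft
    · simp only [Walk.support_nil, List.mem_singleton]
      rintro u rfl v rfl h
      exact absurd rfl h
  | @cons a a' b hadj W ih =>
    obtain ⟨C, e, hCA, hCl, hel, heC, hcond⟩ := exists_two_colors A l D q hAl
    simp only [Walk.support_cons, List.nodup_cons] at hW
    obtain ⟨haW, hWn⟩ := hW
    obtain ⟨c', φ', t, hE, ⟨htD, htq, ha'C, ha'e, hbD, hbt⟩, hF⟩ :=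
      ih hWn C e heC.symm fun _ => hcond
    -- The fourth color, absent from `a` and both edges of the ear at `a`, is the one reserved
    -- there.
    obtain ⟨f, hfl, hfe, hfC⟩ := exists_ne_three l e C
    set c : TotalColoring V (Fin 4) :=
      ⟨Function.update c'.vert a C, Function.update c'.edge s(a, a') e⟩ with hc
    have hca : c.vert a = C := by simp [hc]
    have hce : c.edge s(a, a') = e := by simp [hc]
    have hce' : c.edge s(a', a) = e := by rw [Sym2.eq_swap, hce]
    have hne : ∀ w ∈ W.support, w ≠ a := fun w hw h => haW (h ▸ hw)
    have hcv : ∀ w ∈ W.support, c.vert w = c'.vert w := fun w hw => by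
      simp [hc, hne w hw]
    have tr : ∀ {α u v β}, Linked G c' {w | w ∈ W.support} α u v β →
        Linked G c {w | w ∈ W.support} α u v β := fun h => h.congr hcv fun x hx y hy _ => by
      refine Function.update_of_ne (fun hh => ?_) _ _
      rcases Sym2.eq_iff.1 hh with ⟨h, -⟩ | ⟨-, h⟩
      exacts [hne x hx h, hne y hy h]
    have ha'W : a' ∈ W.support := W.start_mem_support
    have hpp : ProperPair c a a' := by
      refine ⟨?_, ?_, ?_⟩ <;> simp only [hca, hce, hcv a' ha'W]
      exacts [ha'C.symm, heC.symm, ha'e]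
    have hdis : Disjoint ({a} : Set V) {w | w ∈ W.support} := by
      simpa using haW
    have hset : ({a} : Set V) ∪ {w | w ∈ W.support} =
        {w | w ∈ (Walk.cons hadj W).support} := by
      ext w; simp
    have cross : ∀ {α v β}, α ≠ e → Linked G c' {w | w ∈ W.support} e a' v β →
        Linked G c {w | w ∈ (Walk.cons hadj W).support} α a v β := fun hα h => by
      rw [← hset]
      exact (Linked.nil (Set.mem_singleton a) (by rwa [hce])).join hadj hpp (by rw [hce]; exact tr h) hdis
    have up : ∀ {α u v β}, Linked G c' {w | w ∈ W.support} α u v β →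
        Linked G c {w | w ∈ (Walk.cons hadj W).support} α u v β := fun h =>
      (tr h).mono le_rfl fun w hw => by
        rw [← hset]; exact Or.inr hw
    set φ : V → Fin 4 := Function.update φ' a f with hφ
    have hφa : φ a = f := by simp [hφ]
    have hφW : ∀ w ∈ W.support, φ w = φ' w := fun w hw => by simp [hφ, hne w hw]
    have hcond' : ∀ {P : V → Prop}, P a → (∀ w ∈ W.support, P w) →
        ∀ w ∈ (Walk.cons hadj W).support, P w := fun h1 h2 w hw => by
      rcases List.mem_cons.1 hw with rfl | h
      exacts [h1, h2 w h]
    have hfirst : ∀ w ∈ W.support,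
        Linked G c {w | w ∈ (Walk.cons hadj W).support} f a w (φ w) := fun w hw => by
      rw [hφW w hw]
      exact cross hfe (hE.start w hw).symm
    refine ⟨c, φ, t, ⟨?_, ?_, ?_, ?_⟩, ⟨htD, htq, by rwa [hca], by rwa [hca], ?_, ?_⟩,
      cross hel.symm hF⟩
    · refine hcond' (by rwa [hφa, hca]) fun w hw => ?_
      rw [hφW w hw, hcv w hw]
      exact hE.ne w hw
    · refine hcond' (.nil (by simp) (by rwa [hφa])) fun w hw => ?_
      rw [hφW w hw]
      exact (cross hel.symm (hE.start w hw).symm).symm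
    · refine hcond' (by rw [hφa]; exact cross hfe hF) fun w hw => ?_
      rw [hφW w hw]
      exact up (hE.finish w hw)
    · refine hcond' (hcond' (fun h => absurd rfl h) fun w hw _ => ?_) fun w hw => ?_
      · rw [hφa]; exact hfirst w hw
      · refine hcond' (fun _ => ?_) fun z hz hwz => ?_
        · rw [hφa]; exact (hfirst w hw).symm
        · rw [hφW w hw, hφW z hz]
          exact up (hE.link w hw z hz hwz)
    · rwa [hcv b W.end_mem_support]
    · rwa [hcv b W.end_mem_support]

/-- Extending a set by an ear needs no passage through the whole ear. Without it, a single inner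
vertex may have `t = l`, and no room at the ends is required. -/
theorem exists_earColoring {G : SimpleGraph V} (D q : Fin 4) {a b : V} (W : G.Walk a b)
    (hW : W.support.Nodup) (A l : Fin 4) (hAl : A ≠ l) :
    ∃ (c : TotalColoring V (Fin 4)) (φ : V → Fin 4) (t : Fin 4), EarColoring G W c φ l t ∧
      (t ≠ D ∧ t ≠ q ∧ c.vert a ≠ A ∧ c.vert a ≠ l ∧ c.vert b ≠ D ∧ c.vert b ≠ t) := by
  cases W with
  | nil =>
    obtain ⟨C, h1, h2, h3⟩ := exists_ne_three A l D
    obtain ⟨t, h4, h5, h6⟩ := exists_ne_three D q C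
    obtain ⟨f, hfl, hft, hfC⟩ := exists_ne_three l t C
    refine ⟨⟨fun _ => C, fun _ => C⟩, fun _ => f, t, ⟨?_, ?_, ?_, ?_⟩,
      h4, h5, h1, h2, h3, h6.symm⟩
    · simpa using hfC
    · simpa using Linked.nil (by simp) hfl
    · simpa using Linked.nil (by simp) hft
    · simp only [Walk.support_nil, List.mem_singleton]
      rintro u rfl v rfl h
      exact absurd rfl h
  | cons h W =>
    obtain ⟨c, φ, t, hE, ht, -⟩ := exists_earColoring_through D q (.cons h W) hW A l hAl (by simp)
    exact ⟨c, φ, t, hE, ht⟩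

/-! ### Bridgeless graphs: growing by ears -/

/-- Any two vertices of `S` are linked within `S`, the color `φ v` being reserved at each `v`. -/
structure ReservingOn (G : SimpleGraph V) (S : Set V) (c : TotalColoring V K) (φ : V → K) :
    Prop where
  ne : ∀ v ∈ S, φ v ≠ c.vert v
  link : ∀ u ∈ S, ∀ v ∈ S, u ≠ v → Linked G c S (φ u) u v (φ v)

theorem ReservingOn.exists_union_ear {G : SimpleGraph V} {S : Set V}
    {c₀ : TotalColoring V (Fin 4)} {φ₀ : V → Fin 4} (h₀ : ReservingOn G S c₀ φ₀)
    {x y a b : V} (hx : x ∈ S) (hy : y ∈ S) (W : G.Walk a b) (hW : W.support.Nodup)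
    (hWS : ∀ w ∈ W.support, w ∉ S) (hxa : G.Adj x a) (hby : G.Adj b y) (hne : a ≠ b ∨ x ≠ y) :
    ∃ (c : TotalColoring V (Fin 4)) (φ : V → Fin 4),
      ReservingOn G (S ∪ {w | w ∈ W.support}) c φ := by
  classical
  -- `q` is the only color that may block the old link from `y` to `x`; the closing edge will avoid
  -- it.
  obtain ⟨q, hq⟩ : ∃ q, ∀ γ ≠ q, Linked G c₀ S γ y x (φ₀ x) := by
    by_cases hyx : y = x
    · subst hyx
      exact ⟨φ₀ y, fun γ hγ => .nil hy hγ⟩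
    · exact (h₀.link y hy x hx hyx).exists_first hyx
  obtain ⟨c₁, φ₁, t, hE, htD, htq, haA, hal, hbD, hbt⟩ :=
    exists_earColoring (c₀.vert y) q W hW (c₀.vert x) (φ₀ x) (h₀.ne x hx).symm
  have haW := W.start_mem_support
  have hbW := W.end_mem_support
  set c : TotalColoring V (Fin 4) :=
    ⟨fun v => if v ∈ S then c₀.vert v else c₁.vert v,
      fun e => if ∀ w ∈ e, w ∈ S then c₀.edge e else
        if ∀ w ∈ e, w ∈ W.support then c₁.edge e else
          if e = s(x, a) then φ₀ x else t⟩ with hc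
  set φ : V → Fin 4 := fun v => if v ∈ S then φ₀ v else φ₁ v with hφ
  have hcS : ∀ v ∈ S, c.vert v = c₀.vert v := fun v hv => if_pos hv
  have hcW : ∀ v ∈ W.support, c.vert v = c₁.vert v := fun v hv => if_neg (hWS v hv)
  have hφS : ∀ v ∈ S, φ v = φ₀ v := fun v hv => if_pos hv
  have hφW : ∀ v ∈ W.support, φ v = φ₁ v := fun v hv => if_neg (hWS v hv)
  have hxW : x ∉ W.support := fun h => hWS x h hx
  have hyW : y ∉ W.support := fun h => hWS y h hy
  have hcl : c.edge s(x, a) = φ₀ x := by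
    simp [hc, hWS a haW, hxW]
  have hct : c.edge s(b, y) = t := by
    have : s(b, y) ≠ s(x, a) := fun h => by
      rcases Sym2.eq_iff.1 h with ⟨h, -⟩ | ⟨h1, h2⟩
      · exact hWS b hbW (h ▸ hx)
      · exact hne.elim (fun h => h h1.symm) (fun h => h h2.symm)
    simp only [hc, Sym2.mem_iff, forall_eq_or_imp, forall_eq, hWS b hbW, hyW, this, false_and,
      and_false, if_false]
  have trS : ∀ {α u v β}, Linked G c₀ S α u v β → Linked G c S α u v β := fun h =>
    h.congr hcS fun u hu v hv _ => if_pos (by simp [hu, hv])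
  have trW : ∀ {α u v β}, Linked G c₁ {w | w ∈ W.support} α u v β →
      Linked G c {w | w ∈ W.support} α u v β := fun h =>
    h.congr hcW fun u (hu : u ∈ W.support) v (hv : v ∈ W.support) _ => by
      simp [hc, hu, hv, hWS u hu]
  have hdis : Disjoint {w | w ∈ W.support} S := Set.disjoint_left.2 hWS
  have hcl' : c.edge s(a, x) = φ₀ x := by rw [Sym2.eq_swap, hcl]
  have hpa : ProperPair c a x := by
    refine ⟨?_, ?_, ?_⟩ <;> simp only [hcl', hcW a haW, hcS x hx]
    exacts [haA, hal, (h₀.ne x hx).symm]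
  have hpb : ProperPair c b y := by
    refine ⟨?_, ?_, ?_⟩ <;> simp only [hct, hcW b hbW, hcS y hy]
    exacts [hbD, hbt, htD.symm]
  have hmix : ∀ p ∈ W.support, ∀ u ∈ S,
      Linked G c (S ∪ {w | w ∈ W.support}) (φ p) p u (φ u) := fun p hp u hu => by
    rw [hφW p hp, hφS u hu, Set.union_comm]
    -- The edge `a x` has color `φ₀ x`, which cannot be followed by the same reserved color at `x`,
    -- so `x` is reached through `b` and `y`.
    by_cases hux : u = x
    · subst hux
      exact (trW (hct ▸ hE.finish p hp)).join hby hpb (trS (hct ▸ hq t htq)) hdis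
    · exact (trW (hcl' ▸ hE.start p hp)).join hxa.symm hpa
        (trS (hcl' ▸ h₀.link x hx u hu (Ne.symm hux))) hdis
  refine ⟨c, φ, ?_, ?_⟩
  · rintro v (hv | hv)
    · rw [hφS v hv, hcS v hv]; exact h₀.ne v hv
    · rw [hφW v hv, hcW v hv]; exact hE.ne v hv
  · rintro u (hu | hu) v (hv | hv) huv
    · rw [hφS u hu, hφS v hv]
      exact (trS (h₀.link u hu v hv huv)).mono le_rfl Set.subset_union_left
    · exact (hmix v hv u hu).symm
    · exact hmix u hu v hv
    · rw [hφW u hu, hφW v hv]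
      exact (trW (hE.link u hu v hv huv)).mono le_rfl Set.subset_union_right

/-- A walk into `S` has an initial part outside `S` that ends next to `S`. -/
theorem exists_path_to {G : SimpleGraph V} {S : Set V} {a x : V} (p : G.Walk a x)
    (ha : a ∉ S) (hx : x ∈ S) :
    ∃ (b y : V) (W : G.Walk a b), W.support.Nodup ∧ (∀ w ∈ W.support, w ∉ S) ∧
      G.Adj b y ∧ y ∈ S := by
  classical
  suffices ∃ (b y : V) (W : G.Walk a b), (∀ w ∈ W.support, w ∉ S) ∧ G.Adj b y ∧ y ∈ S by
    obtain ⟨b, y, W, hW, h⟩ := this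
    exact ⟨b, y, W.bypass, W.bypass_isPath.support_nodup,
      fun w hw => hW w (W.support_bypass_subset_support hw), h⟩
  induction p with
  | nil => exact absurd hx ha
  | @cons a a' x h p ih =>
    by_cases ha' : a' ∈ S
    · exact ⟨a, a', .nil, by simpa using ha, h, ha'⟩
    · obtain ⟨b, y, W, hW, hby⟩ := ih ha' hx
      refine ⟨b, y, .cons h W, ?_, hby⟩
      intro w hw
      rcases List.mem_cons.1 hw with rfl | hw
      exacts [ha, hW w hw]

/-- Around every vertex of a finite bridgeless graph, four colors suffice with one color
reserved at each vertex. -/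
theorem exists_reservingOn [Finite V] {G : SimpleGraph V}
    (hG : ∀ e ∈ G.edgeSet, ¬ G.IsBridge e) (r : V) :
    ∃ (S : Set V) (c : TotalColoring V (Fin 4)) (φ : V → Fin 4), r ∈ S ∧ ReservingOn G S c φ ∧
      ∀ u ∈ S, ∀ v, G.Adj u v → v ∈ S := by
  obtain ⟨S, ⟨hrS, c, φ, h⟩, hmax⟩ := (Set.toFinite {S : Set V | r ∈ S ∧
    ∃ (c : TotalColoring V (Fin 4)) (φ : V → Fin 4), ReservingOn G S c φ}).exists_maximal
    ⟨{r}, rfl, ⟨fun _ => 0, fun _ => 0⟩, fun _ => 1, by simp, by simp⟩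
  refine ⟨S, c, φ, hrS, h, fun x hx a hxa => ?_⟩
  by_contra ha
  have hnb := hG s(x, a) hxa
  rw [isBridge_iff, not_not] at hnb
  obtain ⟨p⟩ := hnb.symm
  obtain ⟨b, y, W, hW, hWS, hby, hy⟩ := exists_path_to p ha hx
  have hle : G.deleteEdges {s(x, a)} ≤ G := deleteEdges_le _
  -- The return path avoids the edge `x a`, so the ear has two different attaching edges.
  have hne : a ≠ b ∨ x ≠ y := by
    by_contra! hcon
    obtain ⟨rfl, rfl⟩ := hcon
    simp [deleteEdges_adj, Sym2.eq_swap] at hby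
  have := h.exists_union_ear hx hy (W.mapLe hle) (by simpa using hW) (by simpa using hWS) hxa
    (hle hby) hne
  have haS := hmax ⟨Or.inl hrS, this⟩ Set.subset_union_left (show a ∈ S ∪ _ from Or.inr (by simp))
  exact ha haS

/-- Four colors suffice in a finite bridgeless graph, connected or not, with one color reserved
at each vertex. -/
theorem exists_reserving [Finite V] {G : SimpleGraph V}
    (hG : ∀ e ∈ G.edgeSet, ¬ G.IsBridge e) :
    ∃ (c : TotalColoring V (Fin 4)) (φ : V → Fin 4), (∀ v, φ v ≠ c.vert v) ∧
      ∀ u v, G.Reachable u v → u ≠ v → Linked G c Set.univ (φ u) u v (φ v) := by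
  choose S c φ hrS hres hcl using exists_reservingOn hG
  -- All vertices of a component use the coloring found around one common representative.
  let R : V → V := fun v => (G.connectedComponentMk v).out
  have hR : ∀ {u v}, G.Reachable u v → R u = R v := fun h => by
    simp only [R, ConnectedComponent.sound h]
  have hRS : ∀ v, v ∈ S (R v) := fun v => by
    have h : G.Reachable (R v) v := ConnectedComponent.exact (Quot.out_eq _)
    have : ∀ {a b : V}, G.Walk a b → a ∈ S (R v) → b ∈ S (R v) := fun p => by
      induction p with
      | nil => exact id
      | cons h _ ih => exact fun ha => ih (hcl _ _ ha _ h)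
    obtain ⟨p⟩ := h
    exact this p (hrS _)
  refine ⟨⟨fun v => (c (R v)).vert v, fun e => (c (R e.out.1)).edge e⟩, fun v => φ (R v) v,
    fun v => (hres (R v)).ne v (hRS v), fun u v huv hne => ?_⟩
  have hl := (hres (R u)).link u (hRS u) v (hR huv ▸ hRS v) hne
  have hφv : φ (R v) v = φ (R u) v := by rw [hR huv]
  dsimp only
  rw [hφv]
  refine (hl.inter_reachable.congr (fun a ha => ?_) fun a ha b hb _ => ?_).mono le_rfl
    (Set.subset_univ _)
  · simp only [hR ha.2]
  · have : R s(a, b).out.1 = R u := by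
      rcases Sym2.mem_iff.1 (Sym2.out_fst_mem s(a, b)) with h | h <;> rw [h]
      exacts [(hR ha.2).symm, (hR hb.2).symm]
    simp only [this]

/-! ### Reserving several colors at a vertex -/

/-- Any two vertices of a component are linked while all colors of `F v` are reserved at `v`, the
number of these colors being `h v`. -/
structure ReservingSets [DecidableEq K] (G : SimpleGraph V) (h : V → ℕ) (c : TotalColoring V K)
    (F : V → Finset K) : Prop where
  notMem : ∀ v, c.vert v ∉ F v
  card_eq : ∀ v, (F v).card = h v
  link : ∀ u v, G.Reachable u v → u ≠ v → ∀ α ∈ insert (c.vert u) (F u),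
    ∀ β ∈ insert (c.vert v) (F v), Linked G c Set.univ α u v β

theorem one_lt_ncard_neighborSet [Finite V] {G : SimpleGraph V} {v w : V} (h : G.Adj v w)
    (hb : ¬ G.IsBridge s(v, w)) : 1 < (G.neighborSet v).ncard := by
  rw [isBridge_iff, not_not] at hb
  obtain ⟨p⟩ := hb
  cases p with
  | nil => exact absurd h G.irrefl
  | @cons _ z _ hz p =>
    rw [deleteEdges_adj] at hz
    refine (Set.one_lt_ncard (Set.toFinite _)).2 ⟨z, hz.1, w, h, ?_⟩
    rintro rfl
    exact hz.2 rfl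

/-- The four-coloring is embedded into `k` colors. Colors outside its image occur on no edge, so
they can be reserved for free, besides `φ v`. -/
theorem exists_reservingSets_of_bridgeless [Finite V] {G : SimpleGraph V}
    (hG : ∀ e ∈ G.edgeSet, ¬ G.IsBridge e) {k : ℕ} (hk : 4 ≤ k) (h : V → ℕ)
    (hh : ∀ v, 0 < h v → (G.neighborSet v).ncard + h v + 1 ≤ k) :
    ∃ (c : TotalColoring V (Fin k)) (F : V → Finset (Fin k)), ReservingSets G h c F := by
  classical
  obtain ⟨c₄, φ, hφ, hl⟩ := exists_reserving hG
  have hinj := Fin.castLE_injective hk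
  set ι : Fin 4 → Fin k := Fin.castLE hk with hι
  set c : TotalColoring V (Fin k) := ⟨ι ∘ c₄.vert, ι ∘ c₄.edge⟩ with hc
  have hF : ∀ v, ∃ F : Finset (Fin k), c.vert v ∉ F ∧ F.card = h v ∧
      ((∃ w, G.Adj v w) → ∀ α ∈ F, α = ι (φ v) ∨ ∀ i, α ≠ ι i) := fun v => by
    by_cases hv : 0 < h v
    · have hd := hh v hv
      by_cases hw : ∃ w, G.Adj v w
      · obtain ⟨w, hw⟩ := hw
        have h2 := one_lt_ncard_neighborSet hw (hG _ hw)
        set P : Finset (Fin k) := insert (ι (φ v)) (Finset.univ.image ι)ᶜ with hP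
        have hPc : P.card = k - 4 + 1 := by
          rw [hP, Finset.card_insert_of_notMem (by simp), Finset.card_compl,
            Finset.card_image_of_injective _ hinj]
          simp
        obtain ⟨F, hFP, hFc⟩ := Finset.exists_subset_card_eq (show h v ≤ P.card by omega)
        have hmem : ∀ α ∈ F, α = ι (φ v) ∨ ∀ i, α ≠ ι i := fun α hα => by
          have := hFP hα
          simp only [hP, Finset.mem_insert, Finset.mem_compl, Finset.mem_image, Finset.mem_univ,
            true_and, not_exists] at this
          exact this.imp_right fun h i hi => h i hi.symm
        refine ⟨F, fun hcF => ?_, hFc, fun _ => hmem⟩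
        rcases hmem _ hcF with h | h
        · exact hφ v (hinj h).symm
        · exact h _ rfl
      -- An isolated vertex starts no nontrivial link, so every color but its own may be reserved.
      · obtain ⟨F, hFP, hFc⟩ := Finset.exists_subset_card_eq
          (show h v ≤ (Finset.univ.erase (c.vert v)).card by
            rw [Finset.card_erase_of_mem (Finset.mem_univ _), Finset.card_fin]; omega)
        exact ⟨F, fun hcF => by simpa using hFP hcF, hFc, fun h => absurd h hw⟩
    · exact ⟨∅, by simp, by simp; omega, by simp⟩
  choose F hcF hFc hFm using hF
  have hstart : ∀ {u v γ}, G.Reachable u v → u ≠ v →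
      Linked G c Set.univ (ι (φ u)) u v γ → ∀ α ∈ insert (c.vert u) (F u),
        Linked G c Set.univ α u v γ := fun {u v γ} huv hne hlink α hα => by
    have hadj : ∃ w, G.Adj u w := by
      obtain ⟨p⟩ := huv
      cases p with
      | nil => exact absurd rfl hne
      | cons h _ => exact ⟨_, h⟩
    rcases Finset.mem_insert.1 hα with rfl | hα
    · exact hlink.start_ne hne fun w _ hw _ => hw.2.1
    · rcases hFm u hadj α hα with rfl | hα
      · exact hlink
      · exact hlink.start_ne hne fun w _ _ _ => hα _
  refine ⟨c, F, hcF, hFc, fun u v huv hne α hα β hβ => ?_⟩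
  exact (hstart huv.symm hne.symm
    (hstart huv hne ((hl u v huv hne).map_colors hinj) α hα).symm β hβ).symm

/-! ### Deleting and restoring bridges -/

theorem exists_perm_of_ne [DecidableEq K] {a b a' b' : K} (h : a ≠ b) (h' : a' ≠ b') :
    ∃ σ : Equiv.Perm K, σ a = a' ∧ σ b = b' := by
  refine ⟨Equiv.swap (Equiv.swap a a' b) b' * Equiv.swap a a', ?_, ?_⟩
  · have : a' ≠ Equiv.swap a a' b := fun hh => by
      rw [← Equiv.swap_apply_left a a'] at hh
      exact h ((Equiv.swap a a').injective (by simpa using hh))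
    simp [Equiv.swap_apply_of_ne_of_ne this h']
  · simp

theorem reachable_deleteEdges_or {G : SimpleGraph V} {x y u v : V} (h : G.Reachable u v) :
    (G.deleteEdges {s(x, y)}).Reachable u v ∨
    ((G.deleteEdges {s(x, y)}).Reachable u x ∧ (G.deleteEdges {s(x, y)}).Reachable y v) ∨
    ((G.deleteEdges {s(x, y)}).Reachable u y ∧ (G.deleteEdges {s(x, y)}).Reachable x v) := by
  obtain ⟨p⟩ := h
  induction p with
  | nil => exact Or.inl .rfl
  | @cons a b w hab p ih =>
    by_cases he : s(a, b) = s(x, y)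
    · rcases Sym2.eq_iff.1 he with ⟨rfl, rfl⟩ | ⟨rfl, rfl⟩
      · rcases ih with ih | ⟨h1, h2⟩ | ⟨h1, h2⟩
        · exact Or.inr (Or.inl ⟨.rfl, ih⟩)
        · exact Or.inr (Or.inl ⟨.rfl, h2⟩)
        · exact Or.inl h2
      · rcases ih with ih | ⟨h1, h2⟩ | ⟨h1, h2⟩
        · exact Or.inr (Or.inr ⟨.rfl, ih⟩)
        · exact Or.inl h2
        · exact Or.inr (Or.inr ⟨.rfl, h2⟩)
    · have h' : (G.deleteEdges {s(x, y)}).Reachable a b :=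
        Adj.reachable (by rw [deleteEdges_adj]; exact ⟨hab, he⟩)
      exact ih.imp h'.trans (Or.imp (And.imp_left h'.trans) (And.imp_left h'.trans))

/-- Permuting the colors on the side `T` of `y` does not affect the other side. It turns a reserved
color of `y` into the reserved color `α₀` of `x`, which then colors the bridge and is no longer
reserved at its ends. -/
theorem ReservingSets.of_deleteEdges [DecidableEq V] [DecidableEq K] {G : SimpleGraph V} {x y : V}
    (hadj : G.Adj x y)
    (hb : G.IsBridge s(x, y)) (hK : ∀ a b : K, ∃ γ, γ ≠ a ∧ γ ≠ b) {h : V → ℕ}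
    {c' : TotalColoring V K} {F' : V → Finset K}
    (hres : ReservingSets (G.deleteEdges {s(x, y)})
      (fun v => h v + if v = x ∨ v = y then 1 else 0) c' F') :
    ∃ (c : TotalColoring V K) (F : V → Finset K), ReservingSets G h c F := by
  classical
  rw [isBridge_iff] at hb
  set G' := G.deleteEdges {s(x, y)} with hG'
  have hG'G : G' ≤ G := deleteEdges_le _
  obtain ⟨α₀, hα₀⟩ : (F' x).Nonempty := by
    rw [← Finset.card_pos, hres.card_eq]; simp
  obtain ⟨β₀, hβ₀⟩ : (F' y).Nonempty := by
    rw [← Finset.card_pos, hres.card_eq]; simp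
  have hxα : c'.vert x ≠ α₀ := fun h => hres.notMem x (h ▸ hα₀)
  have hyβ : β₀ ≠ c'.vert y := fun h => hres.notMem y (h ▸ hβ₀)
  -- `γ` becomes the new color of `y`; it must differ from both the bridge and `x`.
  obtain ⟨γ, hγα, hγx⟩ := hK α₀ (c'.vert x)
  obtain ⟨σ, hσβ, hσy⟩ := exists_perm_of_ne hyβ hγα.symm
  set T : Set V := {v | G'.Reachable y v} with hT
  have hyT : y ∈ T := Reachable.refl y
  have hxT : x ∉ T := fun h => hb h.symm
  set c : TotalColoring V K :=
    ⟨fun v => if v ∈ T then σ (c'.vert v) else c'.vert v,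
      fun e => if e = s(x, y) then α₀ else
        if ∀ w ∈ e, w ∈ T then σ (c'.edge e) else c'.edge e⟩ with hc
  set F : V → Finset K := fun v => (if v ∈ T then (F' v).image σ else F' v) \
    (if v = x ∨ v = y then {α₀} else ∅) with hF
  have hcT : ∀ v ∈ T, c.vert v = σ (c'.vert v) := fun v hv => if_pos hv
  have hcN : ∀ v ∉ T, c.vert v = c'.vert v := fun v hv => if_neg hv
  have hcxy : c.edge s(x, y) = α₀ := if_pos rfl
  have hcyx : c.edge s(y, x) = α₀ := by rw [Sym2.eq_swap, hcxy]
  have hpp : ProperPair c x y := by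
    refine ⟨?_, ?_, ?_⟩ <;> simp only [hcxy, hcN x hxT, hcT y hyT, hσy]
    exacts [hγx.symm, hxα, hγα]
  have hedge : ∀ {a b}, G'.Adj a b → s(a, b) ≠ s(x, y) := fun hab => by
    rw [hG', deleteEdges_adj] at hab
    exact hab.2
  have trT : ∀ {α u v β}, u ∈ T → Linked G' c' Set.univ α u v β →
      Linked G c T (σ α) u v (σ β) := fun {α u v β} hu hl => by
    have h1 := (hl.map_colors σ.injective).inter_reachable.mono le_rfl
      (B := T) (fun w hw => Reachable.trans hu hw.2)
    refine (h1.congr hcT fun a ha b hb hab => ?_).mono hG'G subset_rfl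
    simp [hc, hedge hab, ha, hb]
  have trN : ∀ {α u v β}, u ∉ T → Linked G' c' Set.univ α u v β →
      Linked G c Tᶜ α u v β := fun {α u v β} hu hl => by
    have h1 := hl.inter_reachable.mono le_rfl
      (B := Tᶜ) (fun w hw hwT => hu (Reachable.trans hwT (Reachable.symm hw.2)))
    refine (h1.congr hcN fun a ha b hb hab => ?_).mono hG'G subset_rfl
    have ha' : a ∉ T := ha
    simp [hc, hedge hab, ha']
  have memT : ∀ {u α}, u ∈ T → α ∈ insert (c.vert u) (F u) →
      ∃ α' ∈ insert (c'.vert u) (F' u), σ α' = α ∧ (u = y → α₀ ≠ α) := fun {u α} hu hα => by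
    rcases Finset.mem_insert.1 hα with rfl | hα
    · refine ⟨_, Finset.mem_insert_self .., (hcT u hu).symm, ?_⟩
      rintro rfl
      rw [hcT u hu, hσy]; exact hγα.symm
    · simp only [hF, hu, if_true, Finset.mem_sdiff, Finset.mem_image] at hα
      obtain ⟨⟨α', hα', rfl⟩, hn⟩ := hα
      refine ⟨α', Finset.mem_insert_of_mem hα', rfl, ?_⟩
      rintro rfl h
      simp [h] at hn
  have memN : ∀ {u α}, u ∉ T → α ∈ insert (c.vert u) (F u) →
      α ∈ insert (c'.vert u) (F' u) ∧ (u = x → α ≠ α₀) := fun {u α} hu hα => by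
    rcases Finset.mem_insert.1 hα with rfl | hα
    · rw [hcN u hu]
      exact ⟨Finset.mem_insert_self .., by rintro rfl; exact hxα⟩
    · simp only [hF, hu, if_false, Finset.mem_sdiff] at hα
      refine ⟨Finset.mem_insert_of_mem hα.1, ?_⟩
      rintro rfl h
      simp [h] at hα
  have toX : ∀ {u α}, G'.Reachable u x → α ∈ insert (c.vert u) (F u) →
      Linked G c Tᶜ α u x α₀ := fun {u α} hux hα => by
    have huT : u ∉ T := fun h => hxT (Reachable.trans h hux)
    obtain ⟨hα', hne⟩ := memN huT hα
    by_cases h : u = x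
    · subst h; exact .nil huT (hne rfl)
    · exact trN huT (hres.link u x hux h α hα' α₀ (Finset.mem_insert_of_mem hα₀))
  have toY : ∀ {v β}, G'.Reachable y v → β ∈ insert (c.vert v) (F v) →
      Linked G c T α₀ y v β := fun {v β} hyv hβ => by
    obtain ⟨β', hβ', rfl, hne⟩ := memT hyv hβ
    by_cases h : v = y
    · subst h; exact .nil hyT (hne rfl)
    · rw [← hσβ]
      exact trT hyT (hres.link y v hyv (Ne.symm h) β₀ (Finset.mem_insert_of_mem hβ₀) β' hβ')
  have across : ∀ {u v α β}, G'.Reachable u x → G'.Reachable y v →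
      α ∈ insert (c.vert u) (F u) → β ∈ insert (c.vert v) (F v) →
      Linked G c Set.univ α u v β := fun hux hyv hα hβ => by
    have := (hcxy ▸ toX hux hα : Linked G c Tᶜ _ _ _ (c.edge s(x, y))).join hadj hpp
      (hcxy.symm ▸ toY hyv hβ) disjoint_compl_left
    exact this.mono le_rfl (Set.subset_univ _)
  refine ⟨c, F, fun v hv => ?_, fun v => ?_, fun u v huv hne α hα β hβ => ?_⟩
  · have h1 := (Finset.mem_sdiff.1 hv).1
    by_cases hvT : v ∈ T
    · rw [if_pos hvT, hcT v hvT, Finset.mem_image] at h1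
      obtain ⟨a, ha, hav⟩ := h1
      exact hres.notMem v (σ.injective hav ▸ ha)
    · rw [if_neg hvT, hcN v hvT] at h1
      exact hres.notMem v h1
  · have h1 : (if v ∈ T then (F' v).image σ else F' v).card =
        h v + if v = x ∨ v = y then 1 else 0 := by
      rw [← hres.card_eq v]
      split_ifs
      · exact Finset.card_image_of_injective _ σ.injective
      · rfl
    by_cases hv : v = x ∨ v = y
    · have h2 : α₀ ∈ (if v ∈ T then (F' v).image σ else F' v) := by
        rcases hv with rfl | rfl
        · rwa [if_neg hxT]
        · rw [if_pos hyT]; exact Finset.mem_image.2 ⟨β₀, hβ₀, hσβ⟩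
      rw [if_pos hv] at h1
      simp only [hF, if_pos hv]
      rw [Finset.card_sdiff_of_subset (by simpa using h2), h1]
      simp
    · rw [if_neg hv] at h1
      simp only [hF, if_neg hv, Finset.sdiff_empty]
      exact h1
  · rcases reachable_deleteEdges_or (x := x) (y := y) huv with h | ⟨h1, h2⟩ | ⟨h1, h2⟩
    · by_cases hu : u ∈ T
      · obtain ⟨α', hα', rfl, -⟩ := memT hu hα
        obtain ⟨β', hβ', rfl, -⟩ := memT (Reachable.trans hu h) hβ
        exact (trT hu (hres.link u v h hne α' hα' β' hβ')).mono le_rfl (Set.subset_univ _)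
      · exact (trN hu (hres.link u v h hne α (memN hu hα).1 β
          (memN (fun hv => hu (Reachable.trans hv h.symm)) hβ).1)).mono le_rfl (Set.subset_univ _)
    · exact across h1 h2 hα hβ
    · exact (across h2.symm h1.symm hβ hα).symm

/-- A bridge lies on no cycle, so its deletion destroys no cycle through `f`. -/
theorem isBridge_of_deleteEdges {G : SimpleGraph V} {e f : Sym2 V} (he : G.IsBridge e)
    (hf : f ∈ (G.deleteEdges {e}).edgeSet) (hb : (G.deleteEdges {e}).IsBridge f) :
    G.IsBridge f := by
  rw [isBridge_iff_forall_cycle_notMem hf] at hb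
  rw [isBridge_iff_forall_cycle_notMem (edgeSet_mono (deleteEdges_le _) hf)]
  intro u p hp hfp
  have hpe : ∀ g ∈ p.edges, g ∉ ({e} : Set (Sym2 V)) := fun g hg hge =>
    he.notMem_edges_of_isCycle hp (hge ▸ hg)
  exact hb _ (Walk.IsCycle.toDeleteEdges G _ hp hpe) (by simpa using hfp)

/-- The demand `h` is what makes the induction on edges work: at the ends of a deleted bridge it
grows by one while the degree falls by one. -/
theorem exists_reservingSets [Finite V] {k : ℕ} (hk : 4 ≤ k) (G : SimpleGraph V) (h : V → ℕ)
    (hh : ∀ v, 0 < h v ∨ IsBridgeEndpoint G v → (G.neighborSet v).ncard + h v + 1 ≤ k) :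
    ∃ (c : TotalColoring V (Fin k)) (F : V → Finset (Fin k)), ReservingSets G h c F := by
  classical
  induction hn : G.edgeSet.ncard using Nat.strong_induction_on generalizing G h with
  | _ n ih =>
  by_cases hG : ∀ e ∈ G.edgeSet, ¬ G.IsBridge e
  · exact exists_reservingSets_of_bridgeless hG hk h fun v hv => hh v (Or.inl hv)
  push Not at hG
  obtain ⟨e, he, hb⟩ := hG
  induction e with | h x y =>
  have hxy : G.Adj x y := he
  have hend : ∀ v, v = x ∨ v = y → IsBridgeEndpoint G v := fun v hv =>
    ⟨s(x, y), he, hb, by simpa using hv⟩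
  have hlt : (G.deleteEdges {s(x, y)}).edgeSet.ncard < n := by
    rw [← hn, edgeSet_deleteEdges]
    exact Set.ncard_sdiff_singleton_lt_of_mem he
  have hle : (G.deleteEdges {s(x, y)}) ≤ G := deleteEdges_le _
  have hh' : ∀ v, 0 < (h v + if v = x ∨ v = y then 1 else 0) ∨
      IsBridgeEndpoint (G.deleteEdges {s(x, y)}) v →
      ((G.deleteEdges {s(x, y)}).neighborSet v).ncard +
        (h v + if v = x ∨ v = y then 1 else 0) + 1 ≤ k := fun v hv => by
    have h1 : 0 < h v ∨ IsBridgeEndpoint G v := by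
      by_cases hvxy : v = x ∨ v = y
      · exact Or.inr (hend v hvxy)
      · rw [if_neg hvxy, add_zero] at hv
        refine hv.imp_right ?_
        rintro ⟨f, hf, hfb, hvf⟩
        exact ⟨f, edgeSet_mono hle hf, isBridge_of_deleteEdges hb hf hfb, hvf⟩
    have h2 := hh v h1
    have h3 : ((G.deleteEdges {s(x, y)}).neighborSet v).ncard + (if v = x ∨ v = y then 1 else 0) ≤
        (G.neighborSet v).ncard := by
      have hsub : (G.deleteEdges {s(x, y)}).neighborSet v ⊆ G.neighborSet v := fun w hw => hle hw
      split_ifs with hvxy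
      · refine Set.ncard_lt_ncard (hsub.ssubset_of_ne fun heq => ?_) (Set.toFinite _)
        rcases hvxy with rfl | rfl
        · have : y ∈ G.neighborSet v := hxy
          rw [← heq, mem_neighborSet, deleteEdges_adj] at this
          exact this.2 rfl
        · have : x ∈ G.neighborSet v := hxy.symm
          rw [← heq, mem_neighborSet, deleteEdges_adj] at this
          exact this.2 Sym2.eq_swap
      · exact Set.ncard_le_ncard hsub (Set.toFinite _)
    omega
  obtain ⟨c', F', hres⟩ := ih _ hlt _ _ hh' rfl
  refine hres.of_deleteEdges hxy hb fun a b => ?_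
  obtain ⟨γ, hγ⟩ := Finset.exists_mem_notMem_of_card_lt_card
    (s := {a, b}) (t := (Finset.univ : Finset (Fin k)))
    (Finset.card_le_two.trans_lt (by rw [Finset.card_fin]; omega))
  exact ⟨γ, by simpa using hγ⟩

/-! ### The bound -/

theorem tpc_le [Finite V] {G : SimpleGraph V} (hG : G.Connected) {k : ℕ} (hk : 4 ≤ k)
    (hdeg : ∀ v, IsBridgeEndpoint G v → (G.neighborSet v).ncard + 1 ≤ k) : tpc G ≤ k := by
  -- Nothing is reserved in the end; the vertices' own colors serve as outer colors of the links.
  obtain ⟨c, F, hres⟩ := exists_reservingSets hk G (fun _ => 0) fun v hv =>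
    hdeg v (hv.resolve_left (lt_irrefl 0))
  refine iInf₂_le k ⟨c, fun u v => ?_⟩
  by_cases huv : u = v
  · subst huv
    exact ⟨.nil, by simp, by simp, by simp [internalVertices], by simp [internalVertices]⟩
  · exact (hres.link u v (hG.preconnected u v) huv _ (Finset.mem_insert_self ..) _
      (Finset.mem_insert_self ..)).isTotalProperPath

theorem ncard_neighborSet_le_maxBridgeDegree [Fintype V] {G : SimpleGraph V} {v : V}
    (hv : IsBridgeEndpoint G v) : (G.neighborSet v).ncard ≤ maxBridgeDegree G := by
  classical
  have h : (G.neighborSet v).ncard = G.degree v := by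
    rw [← card_neighborSet_eq_degree, Set.ncard_eq_toFinset_card', Set.toFinset_card]
  rw [h, maxBridgeDegree]
  convert Finset.le_sup (f := fun v => G.degree v) (Finset.mem_filter.2 ⟨Finset.mem_univ v, hv⟩)

end TotalProper

theorem theorem4 {V : Type*} [Fintype V] (G : SimpleGraph V) (hG : G.Connected) :
    (4 ≤ TotalProper.maxBridgeDegree G →
      TotalProper.tpc G ≤ ((TotalProper.maxBridgeDegree G + 1 : ℕ) : ℕ∞)) ∧
    (TotalProper.maxBridgeDegree G < 4 → TotalProper.tpc G ≤ 4) := by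
  refine ⟨fun h => ?_, fun h => ?_⟩
  · exact TotalProper.tpc_le hG (by omega) fun v hv =>
      Nat.succ_le_succ (TotalProper.ncard_neighborSet_le_maxBridgeDegree hv)
  · exact TotalProper.tpc_le hG le_rfl fun v hv =>
      (Nat.succ_le_succ (TotalProper.ncard_neighborSet_le_maxBridgeDegree hv)).trans h
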